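/- For $d\ge 1$ and $L>0$ let $\mathcal F^d_{\mathrm{Leon}}$ be the family of $L$-Lipschitz Leontief losses on $[0,1]^d$, that is, of all functions $f(y)=-\min_{1\le j\le d} y_j/a_j$ on $[0,1]^d$ with real $a_1,\dots,a_d\ge 1/L$. Functions $s_1,\dots,s_n:[0,1]^d\to[0,1]$ are called an $(n,\lambda,\varepsilon)$-approximate basis for a family $\mathcal F$ of functions $[0,1]^d\to\mathbb R$ if for every $f\in\mathcal F$ there are real numbers $r_0,r_1,\dots,r_n$ with $$\Big|r_0+\sum_{i=1}^n r_i s_i(y)-f(y)\Big|\le\varepsilon \quad\text{for all } y\in[0,1]^d,$$ $$\Big|\sum_{i=1}^n r_i s_i(y)-\sum_{i=1}^n r_i s_i(y')\Big|\le\lambda\max_{1\le i\le n}|s_i(y)-s_i(y')| \quad\text{for all } y,y'\in[0,1]^d$$ (for $n=0$ the sums and the maximum are $0$). Proposition. There are universal constants $c,C>0$ such that for all integers $d\ge1$ and all real $L>0$ and $0<\delta\le 1$ the family $\mathcal F^d_{\mathrm{Leon}}$ has an $(n,\lambda,3L\delta)$-approximate basis with $$n\le C\,\frac{d^4c^d\ln^{3d+1}(1/\delta)}{\delta^{(6d+8)/(d+2)}},\qquad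 \lambda\le C\,\frac{L\,d^{5/2}c^d\ln^{2d+1/2}(1/\delta)}{\delta^{(5d+6)/(d+2)}}.$$ -/

import Mathlib

/-- The outcome space `[0,1]^d`. -/
abbrev UnitCube (d : ℕ) : Type := Fin d → unitInterval

/-- `s = (s_1, …, s_n)` is an `(n, lam, ε)`-approximate basis for the family `F` of real functions
on `Y`: the `s_i` take values in `[0,1]`, and for every `f ∈ F` there are real coefficients
`r_0, r_1, …, r_n` such that `r_0 + ∑ r_i s_i` is uniformly within `ε` of `f` and is
`lam`-Lipschitz as a function of `(s_1(y), …, s_n(y))` for the `L_∞` norm.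
(For `n = 0` the maximum on the right-hand side is `0`, as is the left-hand side.) -/
def IsApproxBasis {Y : Type*} (n : ℕ) (lam ε : ℝ) (s : Fin n → Y → ℝ) (F : Set (Y → ℝ)) : Prop :=
  (∀ i y, s i y ∈ Set.Icc (0 : ℝ) 1) ∧
    ∀ f ∈ F, ∃ (r₀ : ℝ) (r : Fin n → ℝ),
      (∀ y, |r₀ + ∑ i, r i * s i y - f y| ≤ ε) ∧
      ∀ y y', |∑ i, r i * s i y - ∑ i, r i * s i y'| ≤ lam * ⨆ i, |s i y - s i y'|

/-- The `L`-Lipschitz Leontief loss functions `y ↦ - min_j (y_j / a_j)` on `[0,1]^d`, with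
`a_j ≥ 1 / L` (used for `d ≥ 1` and `L > 0`; the infimum is over the finite set of indices and so
is a minimum). -/
def leontiefFamily (d : ℕ) (L : ℝ) : Set (UnitCube d → ℝ) :=
  {f | ∃ a : Fin d → ℝ, (∀ j, 1 / L ≤ a j) ∧ ∀ y, f y = -⨅ j, (y j : ℝ) / a j}

/-! After rescaling, a loss is `-L` times a weighted minimum, and a weighted minimum is, up to the
mesh, an average over thresholds of orthant indicators `t < x` on the grid of side `2 ^ m`. It thus
suffices to factor the matrix of these indicators approximately, with few bounded factors.

In one coordinate, `t < x` is decided at a single binary digit. A random digit with random signs on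
its dyadic blocks gives bounded features of `x` and of `t` whose product has mean `1 / m` times the
indicator (`sum_digitFeature_mul`). Products over coordinates have mean `1 / m ^ d` times the
orthant indicator. A Chernoff and union bound over all pairs (`exists_sample_abs_sub_mean_le`)
yields one sample good for every pair, of size about `d * m ^ (2 * d + 1) / δ ^ 2`. The features of
`x` form the basis; those of `t`, averaged over thresholds, give coefficients of absolute sum at
most `m ^ d`. With `m` of order `log (1 / δ)` this is stronger than the required bounds. -/

/-! ### Chernoff bounds by counting samples. -/

lemma exp_mean_le {Ω : Type*} [Fintype Ω] (X : Ω → ℝ) (hX : ∀ ω, |X ω| ≤ 2)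
    (h0 : ∑ ω, X ω = 0) {s : ℝ} (hs0 : 0 ≤ s) (hs : s ≤ 1 / 2) :
    ∑ ω, Real.exp (s * X ω) ≤ Fintype.card Ω * Real.exp (4 * s ^ 2) := by
  have h1 : ∀ ω, Real.exp (s * X ω) ≤ 1 + s * X ω + 4 * s ^ 2 := by
    intro ω
    have hb : |s * X ω| ≤ 1 := by
      rw [abs_mul, abs_of_nonneg hs0]
      nlinarith [hX ω, abs_nonneg (X ω)]
    have h2 := (abs_le.1 (Real.abs_exp_sub_one_sub_id_le hb)).2
    have h3 : X ω ^ 2 ≤ 4 := by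
      rw [← sq_abs]
      nlinarith [hX ω, abs_nonneg (X ω)]
    nlinarith [mul_le_mul_of_nonneg_left h3 (sq_nonneg s)]
  calc ∑ ω, Real.exp (s * X ω) ≤ ∑ ω, (1 + s * X ω + 4 * s ^ 2) :=
        Finset.sum_le_sum fun ω _ => h1 ω
    _ = Fintype.card Ω * (4 * s ^ 2 + 1) := by
        simp only [Finset.sum_add_distrib, ← Finset.mul_sum, h0]
        simp
        ring
    _ ≤ _ := mul_le_mul_of_nonneg_left (Real.add_one_le_exp _) (by positivity)

/-- Exponential moments at `s = ε / 8`, the minimiser of `4 * s ^ 2 - s * ε`: if every sample failed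
for some `p`, the moments summed over `p` would exceed `exp (n * ε ^ 2 / 8)` on average, while each
has average at most `exp (n * ε ^ 2 / 16)`. -/
lemma exists_sample_sum_le {Ω P : Type*} [Fintype Ω] [Nonempty Ω] [Fintype P] (X : P → Ω → ℝ)
    (hX : ∀ p ω, |X p ω| ≤ 2) (h0 : ∀ p, ∑ ω, X p ω = 0) {ε : ℝ} (hε : 0 < ε) (hε4 : ε ≤ 4)
    (n : ℕ) (hn : (Fintype.card P : ℝ) ≤ Real.exp (n * ε ^ 2 / 16)) :
    ∃ ω : Fin n → Ω, ∀ p, ∑ i, X p (ω i) ≤ n * ε := by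
  by_contra! H
  have h1 : ∀ ω : Fin n → Ω, Real.exp (ε / 8 * (n * ε)) <
      ∑ p, Real.exp (ε / 8 * ∑ i, X p (ω i)) := by
    intro ω
    obtain ⟨p, hp⟩ := H ω
    calc _ < Real.exp (ε / 8 * ∑ i, X p (ω i)) := by
          apply Real.exp_lt_exp.2
          exact mul_lt_mul_of_pos_left hp (by positivity)
      _ ≤ _ := Finset.single_le_sum (f := fun p => Real.exp (ε / 8 * ∑ i, X p (ω i)))
          (fun _ _ => (Real.exp_pos _).le) (Finset.mem_univ p)
  have h2 : (Fintype.card Ω : ℝ) ^ n * Real.exp (ε / 8 * (n * ε)) <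
      ∑ ω : Fin n → Ω, ∑ p, Real.exp (ε / 8 * ∑ i, X p (ω i)) := by
    have := Finset.sum_lt_sum_of_nonempty (s := (Finset.univ : Finset (Fin n → Ω)))
      Finset.univ_nonempty (fun ω _ => h1 ω)
    simpa using this
  have h3 : ∀ p, ∑ ω : Fin n → Ω, Real.exp (ε / 8 * ∑ i, X p (ω i)) ≤
      (Fintype.card Ω : ℝ) ^ n * Real.exp (n * ε ^ 2 / 16) := by
    intro p
    have e1 : ∑ ω : Fin n → Ω, Real.exp (ε / 8 * ∑ i, X p (ω i)) =
        (∑ ω, Real.exp (ε / 8 * X p ω)) ^ n := by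
      rw [Fintype.sum_pow]
      refine Finset.sum_congr rfl fun ω _ => ?_
      rw [Finset.mul_sum, Real.exp_sum]
    rw [e1]
    calc _ ≤ (Fintype.card Ω * Real.exp (4 * (ε / 8) ^ 2)) ^ n :=
          pow_le_pow_left₀ (Finset.sum_nonneg fun _ _ => (Real.exp_pos _).le)
            (exp_mean_le _ (hX p) (h0 p) (by positivity) (by linarith)) n
      _ = _ := by
          rw [mul_pow, ← Real.exp_nat_mul]
          congr 2
          ring
  rw [Finset.sum_comm] at h2
  have h4 := h2.trans_le (Finset.sum_le_sum fun p _ => h3 p)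
  rw [Finset.sum_const, nsmul_eq_mul, Finset.card_univ] at h4
  have hc : (0 : ℝ) < (Fintype.card Ω : ℝ) ^ n := by positivity
  have h5 : Real.exp (ε / 8 * (n * ε)) =
      Real.exp (n * ε ^ 2 / 16) * Real.exp (n * ε ^ 2 / 16) := by
    rw [← Real.exp_add]
    congr 1
    ring
  rw [h5] at h4
  have h6 := mul_le_mul_of_nonneg_right hn
    (mul_pos hc (Real.exp_pos (n * ε ^ 2 / 16))).le
  nlinarith

/-- Uniform approximation of means of finitely many bounded functions by a sample. -/
lemma exists_sample_abs_sub_mean_le {Ω P : Type*} [Fintype Ω] [Nonempty Ω] [Fintype P]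
    (g : P → Ω → ℝ) (hg : ∀ p ω, |g p ω| ≤ 1) (μ : P → ℝ)
    (hμ : ∀ p, ∑ ω, g p ω = Fintype.card Ω * μ p) {ε : ℝ} (hε : 0 < ε) (hε4 : ε ≤ 4)
    (n : ℕ) (hn : 2 * (Fintype.card P : ℝ) ≤ Real.exp (n * ε ^ 2 / 16)) :
    ∃ ω : Fin n → Ω, ∀ p, |∑ i, g p (ω i) - n * μ p| ≤ n * ε := by
  have hc : (0 : ℝ) < Fintype.card Ω := by positivity
  have hμ1 : ∀ p, |μ p| ≤ 1 := by
    intro p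
    have h1 : |∑ ω, g p ω| ≤ Fintype.card Ω := by
      refine (Finset.abs_sum_le_sum_abs _ _).trans ?_
      calc _ ≤ ∑ _ω : Ω, (1 : ℝ) := Finset.sum_le_sum fun ω _ => hg p ω
        _ = _ := by simp
    rw [hμ, abs_mul, abs_of_pos hc] at h1
    exact le_of_mul_le_mul_left (by linarith) hc
  have hb : ∀ p ω, |g p ω - μ p| ≤ 2 := fun p ω =>
    (abs_sub _ _).trans (by linarith [hg p ω, hμ1 p])
  -- Two copies of `P` carry the two signs of the deviation; hence the factor 2 in `hn`.
  obtain ⟨ω, hω⟩ := exists_sample_sum_le (P := P ⊕ P)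
    (Sum.elim (fun p ω => g p ω - μ p) (fun p ω => -(g p ω - μ p)))
    (by
      rintro (p | p) ω
      · exact hb p ω
      · simpa only [Sum.elim_inr, abs_neg] using hb p ω)
    (by
      rintro (p | p)
      · simp [hμ]
      · simp [hμ]) hε hε4 n (by
        rw [Fintype.card_sum]
        push_cast
        linarith)
  refine ⟨ω, fun p => abs_le.2 ⟨?_, ?_⟩⟩
  · have := hω (Sum.inr p)
    simp only [Sum.elim_inr, Finset.sum_neg_distrib, Finset.sum_sub_distrib, Finset.sum_const,
      Finset.card_univ, Fintype.card_fin, nsmul_eq_mul] at this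
    linarith
  · have := hω (Sum.inl p)
    simpa only [Sum.elim_inl, Finset.sum_sub_distrib, Finset.sum_const,
      Finset.card_univ, Fintype.card_fin, nsmul_eq_mul] using this

/-! ### Random factorization of the order relation. -/

/-- `x > t` holds exactly when there is a (unique) binary digit at which `x` has `1`, `t` has `0`,
and above which the two agree. -/
lemma indicator_lt_eq_sum_digits (m : ℕ) : ∀ x t : ℕ, x < 2 ^ m → t < 2 ^ m →
    (if t < x then (1 : ℝ) else 0) = ∑ l ∈ Finset.range m,
      (if x / 2 ^ l / 2 = t / 2 ^ l / 2 then (1 : ℝ) else 0) *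
        ((if x / 2 ^ l % 2 = 1 then 1 else 0) * (if t / 2 ^ l % 2 = 0 then 1 else 0)) := by
  induction m with
  | zero =>
    intro x t hx ht
    simp at hx ht
    simp [hx, ht]
  | succ m ih =>
    intro x t hx ht
    -- Splitting off the lowest digit leaves the same sum for `x / 2` and `t / 2`.
    rw [Finset.sum_range_succ']
    have hd : ∀ z l : ℕ, z / 2 ^ (l + 1) = z / 2 / 2 ^ l := fun z l => by
      rw [pow_succ', Nat.div_div_eq_div_mul]
    simp only [hd, pow_zero, Nat.div_one]
    rw [← ih (x / 2) (t / 2) (by rw [pow_succ] at hx; omega) (by rw [pow_succ] at ht; omega)]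
    by_cases h1 : t / 2 < x / 2
    · simp [h1, h1.ne', show t < x by omega]
    · by_cases h2 : x / 2 = t / 2
      · rcases Nat.mod_two_eq_zero_or_one x with hx2 | hx2 <;>
        rcases Nat.mod_two_eq_zero_or_one t with ht2 | ht2
        · simp [h2, hx2, show ¬ t < x by omega]
        · simp [h2, hx2, show ¬ t < x by omega]
        · simp [h2, hx2, ht2, show t < x by omega]
        · simp [h2, ht2, show ¬ t < x by omega]
      · simp [h1, h2, show ¬ t < x by omega]

/-- The sign attached to a Boolean. -/
def boolSign (b : Bool) : ℝ := if b then 1 else -1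

lemma boolSign_mul_self (b : Bool) : boolSign b * boolSign b = 1 := by
  cases b <;> simp [boolSign]

lemma boolSign_not (b : Bool) : boolSign (!b) = -boolSign b := by
  cases b <;> simp [boolSign]

lemma abs_boolSign (b : Bool) : |boolSign b| = 1 := by
  cases b <;> simp [boolSign]

/-- For `p ≠ q`, flipping the sign at `p` is an involution that negates the summand. -/
lemma sum_boolSign_mul {ι : Type*} [Fintype ι] [DecidableEq ι] (p q : ι) :
    ∑ σ : ι → Bool, boolSign (σ p) * boolSign (σ q) =
      Fintype.card (ι → Bool) * (if p = q then 1 else 0) := by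
  split_ifs with h
  · subst h
    simp [boolSign_mul_self]
  · have hinv : Function.Involutive (fun σ : ι → Bool => Function.update σ p (!σ p)) := by
      intro σ
      simp
    have h1 := Equiv.sum_comp (hinv.toPerm _)
      (fun σ : ι → Bool => boolSign (σ p) * boolSign (σ q))
    have h2 : ∀ σ : ι → Bool, boolSign (hinv.toPerm _ σ p) * boolSign (hinv.toPerm _ σ q) =
        -(boolSign (σ p) * boolSign (σ q)) := by
      intro σ
      simp [Function.Involutive.coe_toPerm, Function.update_of_ne (Ne.symm h), boolSign_not]
    simp only [h2, Finset.sum_neg_distrib] at h1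
    linarith

/-- The index of the block of length `2 ^ (l + 1)` containing `x`. -/
def dyadicBlock {m : ℕ} (l : Fin m) (x : Fin (2 ^ m)) : Fin (2 ^ m) :=
  ⟨x / 2 ^ (l : ℕ) / 2, (Nat.div_le_self _ _).trans_lt ((Nat.div_le_self _ _).trans_lt x.2)⟩

/-- The feature attached to a digit position and a choice of signs for the dyadic blocks; it is
supported on the numbers with digit `b` at that position. -/
def digitFeature {m : ℕ} (b : ℕ) (ω : Fin m × (Fin (2 ^ m) → Bool)) (x : Fin (2 ^ m)) : ℝ :=
  boolSign (ω.2 (dyadicBlock ω.1 x)) * (if (x : ℕ) / 2 ^ (ω.1 : ℕ) % 2 = b then 1 else 0)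

lemma abs_digitFeature_le {m : ℕ} (b : ℕ) (ω : Fin m × (Fin (2 ^ m) → Bool)) (x : Fin (2 ^ m)) :
    |digitFeature b ω x| ≤ 1 := by
  rw [digitFeature, abs_mul, abs_boolSign]
  split_ifs <;> simp

/-- Averaging over signs keeps only pairs in a common block, which leaves one term of
`indicator_lt_eq_sum_digits` per digit; the uniform choice of digit costs the factor `1 / m`. -/
lemma sum_digitFeature_mul {m : ℕ} (hm : 0 < m) (x t : Fin (2 ^ m)) :
    ∑ ω : Fin m × (Fin (2 ^ m) → Bool), digitFeature 1 ω x * digitFeature 0 ω t =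
      Fintype.card (Fin m × (Fin (2 ^ m) → Bool)) * ((if t < x then 1 else 0) / m) := by
  rw [Fintype.sum_prod_type]
  have h1 : ∀ l : Fin m, ∑ σ : Fin (2 ^ m) → Bool, digitFeature 1 (l, σ) x * digitFeature 0 (l, σ) t
      = Fintype.card (Fin (2 ^ m) → Bool) *
        ((if (x : ℕ) / 2 ^ (l : ℕ) / 2 = (t : ℕ) / 2 ^ (l : ℕ) / 2 then (1 : ℝ) else 0) *
        ((if (x : ℕ) / 2 ^ (l : ℕ) % 2 = 1 then 1 else 0) *
          (if (t : ℕ) / 2 ^ (l : ℕ) % 2 = 0 then 1 else 0))) := by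
    intro l
    have h2 := sum_boolSign_mul (dyadicBlock l x) (dyadicBlock l t)
    simp only [digitFeature]
    rw [← mul_assoc]
    have h3 : (dyadicBlock l x = dyadicBlock l t) ↔
      (x : ℕ) / 2 ^ (l : ℕ) / 2 = (t : ℕ) / 2 ^ (l : ℕ) / 2 := by
      simp [dyadicBlock]
    simp only [h3] at h2
    rw [← h2, Finset.sum_mul]
    refine Finset.sum_congr rfl fun σ _ => ?_
    ring
  simp only [h1]
  rw [← Finset.mul_sum, Finset.sum_range (n := m) (f := fun l =>
      (if (x : ℕ) / 2 ^ l / 2 = (t : ℕ) / 2 ^ l / 2 then (1 : ℝ) else 0) *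
        ((if (x : ℕ) / 2 ^ l % 2 = 1 then 1 else 0) *
          (if (t : ℕ) / 2 ^ l % 2 = 0 then 1 else 0))) |>.symm,
    ← indicator_lt_eq_sum_digits m x t x.2 t.2, Fintype.card_prod, Fintype.card_fin]
  have : (m : ℝ) ≠ 0 := by positivity
  push_cast
  simp only [Fin.lt_def]
  field_simp

lemma sum_prod_digitFeature_mul {m d : ℕ} (hm : 0 < m) (x t : Fin d → Fin (2 ^ m)) :
    ∑ ω : Fin d → Fin m × (Fin (2 ^ m) → Bool),
        (∏ j, digitFeature 1 (ω j) (x j)) * ∏ j, digitFeature 0 (ω j) (t j) =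
      Fintype.card (Fin d → Fin m × (Fin (2 ^ m) → Bool)) *
        ((if ∀ j, t j < x j then 1 else 0) / (m : ℝ) ^ d) := by
  simp only [← Finset.prod_mul_distrib]
  rw [← Fintype.prod_sum (fun j ω => digitFeature 1 ω (x j) * digitFeature 0 ω (t j))]
  simp only [sum_digitFeature_mul hm]
  rw [Finset.prod_mul_distrib, Finset.prod_div_distrib, Finset.prod_const, Finset.prod_const,
    Finset.card_univ, Fintype.card_fin, Fintype.card_fun, Fintype.card_fin, Nat.cast_pow]
  congr 2
  by_cases h : ∀ j, t j < x j
  · simp [h]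
  · rw [if_neg h]
    push Not at h
    obtain ⟨j, hj⟩ := h
    exact Finset.prod_eq_zero (Finset.mem_univ j) (if_neg (not_lt.2 hj))

lemma abs_prod_digitFeature_le {m d : ℕ} (b : ℕ) (ω : Fin d → Fin m × (Fin (2 ^ m) → Bool))
    (x : Fin d → Fin (2 ^ m)) : |∏ j, digitFeature b (ω j) (x j)| ≤ 1 := by
  rw [Finset.abs_prod]
  exact Finset.prod_le_one (fun _ _ => abs_nonneg _) fun j _ => abs_digitFeature_le _ _ _

/-- Uniform approximation of the orthant indicators on a grid by few products of bounded
functions. -/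
lemma exists_orthant_approx {m d : ℕ} (hm : 0 < m) (hd : 0 < d) {δ : ℝ} (hδ : 0 < δ) (hδ1 : δ ≤ 1)
    (n : ℕ) (hn : 48 * (d * m) * (m : ℝ) ^ (2 * d) / δ ^ 2 ≤ n) :
    ∃ u v : Fin n → (Fin d → Fin (2 ^ m)) → ℝ, (∀ i x, |u i x| ≤ 1) ∧ (∀ i t, |v i t| ≤ 1) ∧
      ∀ x t, |(m : ℝ) ^ d / n * ∑ i, u i x * v i t - (if ∀ j, t j < x j then 1 else 0)| ≤ δ := by
  have : Nonempty (Fin m) := ⟨⟨0, hm⟩⟩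
  have hM : (1 : ℝ) ≤ (m : ℝ) ^ d := one_le_pow₀ (by exact_mod_cast hm)
  have hM0 : (0 : ℝ) < (m : ℝ) ^ d := by linarith
  have hn0 : (0 : ℝ) < n := lt_of_lt_of_le (by positivity) hn
  have hmd : (1 : ℝ) ≤ d * m := by exact_mod_cast Nat.mul_pos hd hm
  obtain ⟨ω, hω⟩ := exists_sample_abs_sub_mean_le
    (Ω := Fin d → Fin m × (Fin (2 ^ m) → Bool))
    (P := (Fin d → Fin (2 ^ m)) × (Fin d → Fin (2 ^ m)))
    (fun p ω => (∏ j, digitFeature 1 (ω j) (p.1 j)) * ∏ j, digitFeature 0 (ω j) (p.2 j))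
    (fun p ω => by
      rw [abs_mul]
      exact mul_le_one₀ (abs_prod_digitFeature_le _ _ _) (abs_nonneg _)
        (abs_prod_digitFeature_le _ _ _))
    (fun p => (if ∀ j, p.2 j < p.1 j then 1 else 0) / (m : ℝ) ^ d)
    (fun p => sum_prod_digitFeature_mul hm p.1 p.2)
    (ε := δ / (m : ℝ) ^ d) (by positivity)
    ((div_le_one hM0).2 (hδ1.trans hM) |>.trans (by norm_num)) n (by
      -- The constant 48 is `3 * 16`: twice the `2 ^ (2 * d * m)` pairs is at most `exp (3 * d *
      -- m)`.
      have h1 : (3 : ℝ) * (d * m) ≤ n * (δ / (m : ℝ) ^ d) ^ 2 / 16 := by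
        rw [div_le_iff₀ (by positivity), mul_comm 2 d, pow_mul] at hn
        rw [div_pow, mul_div_assoc', div_div, le_div_iff₀ (by positivity)]
        linarith
      refine le_trans ?_ (Real.exp_le_exp.2 h1)
      have h2 : (2 : ℝ) ≤ Real.exp 1 := by
        have := Real.add_one_le_exp (1 : ℝ)
        linarith
      calc 2 * (Fintype.card ((Fin d → Fin (2 ^ m)) × (Fin d → Fin (2 ^ m))) : ℝ)
          = 2 ^ (2 * (d * m) + 1) := by
            simp only [Fintype.card_prod, Fintype.card_fun, Fintype.card_fin]
            push_cast
            ring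
        _ ≤ 2 ^ (3 * (d * m)) :=
            pow_le_pow_right₀ (by norm_num) (by have := Nat.mul_pos hd hm; omega)
        _ ≤ Real.exp 1 ^ (3 * (d * m)) := pow_le_pow_left₀ (by norm_num) h2 _
        _ = _ := by
            rw [← Real.exp_nat_mul]
            push_cast
            ring_nf)
  refine ⟨fun i x => ∏ j, digitFeature 1 (ω i j) (x j),
    fun i t => ∏ j, digitFeature 0 (ω i j) (t j), fun i x => abs_prod_digitFeature_le _ _ _,
    fun i t => abs_prod_digitFeature_le _ _ _, fun x t => ?_⟩
  have h := hω (x, t)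
  have hk : (0 : ℝ) < (m : ℝ) ^ d / n := by positivity
  have h2 := mul_le_mul_of_nonneg_left h hk.le
  rw [← abs_of_pos hk, ← abs_mul, abs_of_pos hk] at h2
  have e1 : ∀ S I : ℝ, (m : ℝ) ^ d / n * (S - n * (I / (m : ℝ) ^ d)) =
      (m : ℝ) ^ d / n * S - I := fun S I => by field_simp
  have e2 : (m : ℝ) ^ d / n * (n * (δ / (m : ℝ) ^ d)) = δ := by field_simp
  rwa [e1, e2] at h2

/-! ### Weighted minima as averages of orthant indicators. -/

lemma abs_sum_indicator_lt_sub_le {N : ℕ} {w : ℝ} (hw0 : 0 ≤ w) (hwN : w ≤ N) :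
    |∑ k : Fin N, (if (k : ℝ) < w then (1 : ℝ) else 0) - w| ≤ 1 := by
  have h1 : ∑ k : Fin N, (if (k : ℝ) < w then (1 : ℝ) else 0) = ⌈w⌉₊ := by
    rw [← Finset.sum_range (fun k : ℕ => if (k : ℝ) < w then (1 : ℝ) else 0), Finset.sum_boole]
    congr 1
    have : (Finset.range N).filter (fun k : ℕ => (k : ℝ) < w) = Finset.range ⌈w⌉₊ := by
      ext k
      simp only [Finset.mem_filter, Finset.mem_range, Nat.lt_ceil, and_iff_right_iff_imp]
      intro h
      exact_mod_cast h.trans_le hwN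
    rw [this, Finset.card_range]
  rw [h1, abs_le]
  constructor
  · linarith [Nat.le_ceil w]
  · linarith [Nat.ceil_lt_add_one hw0]

lemma abs_ciInf_sub_ciInf_le {ι : Type*} [Finite ι] [Nonempty ι] (f g : ι → ℝ) {ε : ℝ}
    (h : ∀ i, |f i - g i| ≤ ε) : |(⨅ i, f i) - ⨅ i, g i| ≤ ε := by
  have key : ∀ f g : ι → ℝ, (∀ i, |f i - g i| ≤ ε) → (⨅ i, f i) - ε ≤ ⨅ i, g i := by
    intro f g h
    refine le_ciInf fun i => ?_
    have h1 := ciInf_le (Set.finite_range f).bddBelow i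
    have h2 := (abs_le.1 (h i)).2
    linarith
  have h1 := key f g h
  have h2 := key g f fun i => by rw [abs_sub_comm]; exact h i
  rw [abs_le]
  constructor <;> linarith

/-- The point of the grid `{0, …, N - 1}` (scaled by `1 / N`) next to `y` from below. -/
noncomputable def gridPoint (N : ℕ) [NeZero N] (y : unitInterval) : Fin N :=
  -- Ceiling minus one keeps `y = 1` in the grid; truncated subtraction sends `y = 0` to 0.
  ⟨⌈(y : ℝ) * N⌉₊ - 1, by
    have h : ⌈(y : ℝ) * N⌉₊ ≤ N :=
      Nat.ceil_le.2 (mul_le_of_le_one_left (Nat.cast_nonneg N) y.2.2)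
    have := Nat.pos_of_ne_zero (NeZero.ne N)
    omega⟩

lemma abs_sub_gridPoint_le (N : ℕ) [NeZero N] (y : unitInterval) :
    |(y : ℝ) - (gridPoint N y : ℕ) / N| ≤ 1 / N := by
  have hN : (0 : ℝ) < N := by exact_mod_cast Nat.pos_of_ne_zero (NeZero.ne N)
  have hy : (0 : ℝ) ≤ (y : ℝ) * N := mul_nonneg y.2.1 hN.le
  have h1 : |(y : ℝ) * N - ((⌈(y : ℝ) * N⌉₊ - 1 : ℕ) : ℝ)| ≤ 1 := by
    rcases Nat.eq_zero_or_pos ⌈(y : ℝ) * N⌉₊ with h | h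
    · rw [h]
      have := Nat.le_ceil ((y : ℝ) * N)
      rw [h] at this
      simp only [Nat.cast_zero] at this
      simp [le_antisymm this hy]
    · rw [Nat.cast_sub h, abs_le]
      have h2 := Nat.le_ceil ((y : ℝ) * N)
      have h3 := Nat.ceil_lt_add_one hy
      push_cast
      constructor <;> linarith
  rw [show (y : ℝ) - (gridPoint N y : ℕ) / N = ((y : ℝ) * N - (gridPoint N y : ℕ)) / N by
    field_simp, abs_div, abs_of_pos hN]
  exact div_le_div_of_nonneg_right h1 hN.le

/-- The grid point next to `z` from below, truncated to the grid. -/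
noncomputable def floorGrid (N : ℕ) [NeZero N] (z : ℝ) : Fin N :=
  ⟨min ⌊z⌋₊ (N - 1), by
    have := Nat.pos_of_ne_zero (NeZero.ne N)
    omega⟩

/-- The truncation is harmless because no grid point exceeds `N - 1`. -/
lemma floorGrid_lt_iff {N : ℕ} [NeZero N] {z : ℝ} (hz : 0 ≤ z) (x : Fin N) :
    floorGrid N z < x ↔ z < (x : ℕ) := by
  rw [← Nat.floor_lt hz, Fin.lt_def]
  simp only [floorGrid]
  omega

/-- A weighted minimum is, up to the mesh, an average of orthant indicators on the grid. -/
lemma abs_mean_orthant_sub_ciInf_le {d N : ℕ} [NeZero N] (hd : 0 < d) {b : Fin d → ℝ}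
    (hb : ∀ j, 1 ≤ b j) (y : UnitCube d) :
    |1 / (N : ℝ) * ∑ k : Fin N,
        (if ∀ j, floorGrid N (k * b j) < gridPoint N (y j) then (1 : ℝ) else 0) -
      ⨅ j, (y j : ℝ) / b j| ≤ 2 / N := by
  have : Nonempty (Fin d) := ⟨⟨0, hd⟩⟩
  have hN : (0 : ℝ) < N := by exact_mod_cast Nat.pos_of_ne_zero (NeZero.ne N)
  have hb0 : ∀ j, 0 < b j := fun j => by linarith [hb j]
  set x : Fin d → ℝ := fun j => ((gridPoint N (y j) : ℕ) : ℝ) with hx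
  -- The orthant conditions for threshold `k` say that `k` lies below the weighted minimum, so
  -- summing over `k` counts up to that minimum.
  have hcond : ∀ k : Fin N, (∀ j, floorGrid N (k * b j) < gridPoint N (y j)) ↔
      (k : ℝ) < ⨅ j, x j / b j := by
    intro k
    have h1 : ∀ j, floorGrid N (k * b j) < gridPoint N (y j) ↔ (k : ℝ) < x j / b j := by
      intro j
      rw [floorGrid_lt_iff (mul_nonneg (Nat.cast_nonneg _) (hb0 j).le), lt_div_iff₀ (hb0 j)]
    simp only [h1]
    constructor
    · intro h
      obtain ⟨j, hj⟩ := exists_eq_ciInf_of_finite (f := fun j => x j / b j)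
      rw [← hj]
      exact h j
    · intro h j
      exact h.trans_le (ciInf_le (Set.finite_range _).bddBelow j)
  simp only [hcond]
  have hw0 : 0 ≤ ⨅ j, x j / b j := Real.iInf_nonneg fun j => div_nonneg (Nat.cast_nonneg _) (hb0 j).le
  have hwN : ⨅ j, x j / b j ≤ N := by
    refine (ciInf_le (Set.finite_range _).bddBelow ⟨0, hd⟩).trans ?_
    refine (div_le_self (Nat.cast_nonneg _) (hb _)).trans ?_
    exact_mod_cast (gridPoint N _).2.le
  have h1 := abs_sum_indicator_lt_sub_le hw0 hwN
  have h2 : |1 / (N : ℝ) * (⨅ j, x j / b j) - ⨅ j, (y j : ℝ) / b j| ≤ 1 / N := by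
    rw [Real.mul_iInf_of_nonneg (by positivity)]
    refine abs_ciInf_sub_ciInf_le _ _ fun j => ?_
    rw [abs_sub_comm, show (y j : ℝ) / b j - 1 / N * (x j / b j) = ((y j : ℝ) - x j / N) / b j by
      ring, abs_div, abs_of_pos (hb0 j)]
    exact (div_le_self (abs_nonneg _) (hb j)).trans (abs_sub_gridPoint_le N (y j))
  have h3 : |1 / (N : ℝ) * ∑ k : Fin N, (if (k : ℝ) < ⨅ j, x j / b j then (1 : ℝ) else 0) -
      1 / (N : ℝ) * (⨅ j, x j / b j)| ≤ 1 / N := by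
    rw [← mul_sub, abs_mul, abs_of_pos (by positivity : 0 < 1 / (N : ℝ))]
    exact mul_le_of_le_one_right (by positivity) h1
  calc _ ≤ 1 / (N : ℝ) + 1 / N := (abs_sub_le _ _ _).trans (add_le_add h3 h2)
    _ = _ := by ring

/-! ### The approximate basis and its parameters. -/

/-- Weighted minima are approximated by combinations, with small coefficients, of few bounded
functions. -/
lemma exists_ciInf_approx {m d : ℕ} (hm : 0 < m) (hd : 0 < d) {δ : ℝ} (hδ : 0 < δ) (hδ1 : δ ≤ 1)
    (hmδ : 1 / δ ≤ 2 ^ m) (n : ℕ) (hn : 48 * (d * m) * (m : ℝ) ^ (2 * d) / δ ^ 2 ≤ n) :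
    ∃ u : Fin n → UnitCube d → ℝ, (∀ i y, |u i y| ≤ 1) ∧
      ∀ b : Fin d → ℝ, (∀ j, 1 ≤ b j) → ∃ r : Fin n → ℝ, ∑ i, |r i| ≤ (m : ℝ) ^ d ∧
        ∀ y, |∑ i, r i * u i y - ⨅ j, (y j : ℝ) / b j| ≤ 3 * δ := by
  have H := exists_orthant_approx hm hd hδ hδ1 n hn
  obtain ⟨N, hNdef⟩ : ∃ N, N = 2 ^ m := ⟨_, rfl⟩
  rw [← hNdef] at H
  have hN : (0 : ℝ) < N := by rw [hNdef]; positivity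
  have : NeZero N := ⟨by rw [hNdef]; positivity⟩
  obtain ⟨u, v, hu, hv, huv⟩ := H
  have hn0 : (0 : ℝ) < n := by
    have : (0 : ℝ) < m := by exact_mod_cast hm
    have : (0 : ℝ) < d := by exact_mod_cast hd
    exact lt_of_lt_of_le (by positivity) hn
  refine ⟨fun i y => u i fun j => gridPoint N (y j), fun i y => hu _ _, fun b hb => ?_⟩
  set t : Fin N → Fin d → Fin N := fun k j => floorGrid N (k * b j) with ht
  have habs : ∀ g : Fin N → ℝ, ∀ c, (∀ k, |g k| ≤ c) → |1 / (N : ℝ) * ∑ k, g k| ≤ c := by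
    intro g c hg
    rw [abs_mul, abs_of_pos (by positivity : 0 < 1 / (N : ℝ)), one_div_mul_eq_div,
      div_le_iff₀ hN]
    refine (Finset.abs_sum_le_sum_abs _ _).trans ((Finset.sum_le_sum fun k _ => hg k).trans ?_)
    simp [mul_comm]
  -- Only the corners `t k` depend on `b`, so the weights enter through the coefficients alone. The
  -- error is `δ` from the factorization plus `2 / N` from the mesh.
  refine ⟨fun i => (m : ℝ) ^ d / n * (1 / (N : ℝ) * ∑ k, v i (t k)), ?_, fun y => ?_⟩
  · calc _ ≤ ∑ _i : Fin n, (m : ℝ) ^ d / n := by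
          refine Finset.sum_le_sum fun i _ => ?_
          rw [abs_mul, abs_of_nonneg (by positivity : 0 ≤ (m : ℝ) ^ d / n)]
          exact mul_le_of_le_one_right (by positivity) (habs _ 1 fun k => hv _ _)
      _ = _ := by
          simp only [Finset.sum_const, Finset.card_univ, Fintype.card_fin, nsmul_eq_mul]
          field_simp
  · set x : Fin d → Fin N := fun j => gridPoint N (y j) with hx
    have h1 := habs (fun k => (m : ℝ) ^ d / n * ∑ i, u i x * v i (t k) -
      (if ∀ j, t k j < x j then 1 else 0)) δ fun k => huv x (t k)
    have h2 := abs_mean_orthant_sub_ciInf_le (N := N) hd hb y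
    have e : ∑ i, (m : ℝ) ^ d / n * (1 / (N : ℝ) * ∑ k, v i (t k)) * u i x =
        1 / (N : ℝ) * ∑ k, (m : ℝ) ^ d / n * ∑ i, u i x * v i (t k) := by
      simp only [Finset.mul_sum, Finset.sum_mul]
      rw [Finset.sum_comm]
      refine Finset.sum_congr rfl fun k _ => Finset.sum_congr rfl fun i _ => ?_
      ring
    rw [Finset.sum_sub_distrib, mul_sub, ← e] at h1
    have h3 : 2 / (N : ℝ) ≤ 2 * δ := by
      rw [div_le_iff₀ hδ] at hmδ
      rw [div_le_iff₀ hN, hNdef]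
      push_cast
      linarith
    have h4 := (abs_sub_le _ _ _).trans (add_le_add h1 h2)
    linarith

lemma isApproxBasis_leontiefFamily_of_log {m d : ℕ} (hm : 0 < m) (hd : 0 < d) {L δ : ℝ}
    (hL : 0 < L) (hδ : 0 < δ) (hδ1 : δ ≤ 1) (hmδ : 1 / δ ≤ 2 ^ m) (n : ℕ)
    (hn : 48 * (d * m) * (m : ℝ) ^ (2 * d) / δ ^ 2 ≤ n) :
    ∃ s : Fin n → UnitCube d → ℝ,
      IsApproxBasis n (2 * L * (m : ℝ) ^ d) (3 * L * δ) s (leontiefFamily d L) := by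
  obtain ⟨u, hu, H⟩ := exists_ciInf_approx hm hd hδ hδ1 hmδ n hn
  refine ⟨fun i y => (u i y + 1) / 2, fun i y => ?_, ?_⟩
  · have := abs_le.1 (hu i y)
    constructor <;> linarith
  · rintro f ⟨a, ha, hf⟩
    obtain ⟨r, hr, hry⟩ := H (fun j => L * a j) fun j => by
      have := mul_le_mul_of_nonneg_left (ha j) hL.le
      rwa [mul_one_div_cancel hL.ne'] at this
    -- Substituting `u = 2 * s - 1` doubles the coefficients and produces the constant term.
    refine ⟨L * ∑ i, r i, fun i => -(2 * L) * r i, fun y => ?_, fun y y' => ?_⟩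
    · have e1 : f y = -(L * ⨅ j, (y j : ℝ) / (L * a j)) := by
        rw [hf, Real.mul_iInf_of_nonneg hL.le]
        congr 2
        ext j
        field_simp
      have e2 : ∑ i, -(2 * L) * r i * ((u i y + 1) / 2) = -(L * ∑ i, r i * u i y) - L * ∑ i, r i := by
        rw [Finset.mul_sum, Finset.mul_sum, ← Finset.sum_neg_distrib, ← Finset.sum_sub_distrib]
        exact Finset.sum_congr rfl fun i _ => by ring
      rw [e1, e2, show L * ∑ i, r i + (-(L * ∑ i, r i * u i y) - L * ∑ i, r i) -
          -(L * ⨅ j, (y j : ℝ) / (L * a j)) =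
          -(L * (∑ i, r i * u i y - ⨅ j, (y j : ℝ) / (L * a j))) by ring, abs_neg, abs_mul,
        abs_of_pos hL]
      linarith [mul_le_mul_of_nonneg_left (hry y) hL.le]
    · set D : ℝ := ⨆ i, |(u i y + 1) / 2 - (u i y' + 1) / 2| with hD
      have hD0 : 0 ≤ D := Real.iSup_nonneg fun i => abs_nonneg _
      rw [← Finset.sum_sub_distrib]
      calc _ ≤ ∑ i, 2 * L * |r i| * D := by
            refine (Finset.abs_sum_le_sum_abs _ _).trans (Finset.sum_le_sum fun i _ => ?_)
            rw [← mul_sub, abs_mul, abs_mul, abs_neg, abs_of_pos (by positivity : 0 < 2 * L)]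
            exact mul_le_mul_of_nonneg_left (le_ciSup
              (f := fun i => |(u i y + 1) / 2 - (u i y' + 1) / 2|)
              (Set.finite_range _).bddAbove i) (by positivity)
        _ = 2 * L * (∑ i, |r i|) * D := by rw [Finset.mul_sum, Finset.sum_mul]
        _ ≤ _ := by gcongr

/-- The losses take values in `[-L, 0]`, so the constant `-(L / 2)` suffices. This covers `δ` near
1, where the logarithm in the bounds degenerates. -/
lemma isApproxBasis_leontiefFamily_zero {d : ℕ} (hd : 0 < d) {L δ : ℝ} (hL : 0 < L)
    (hδ : 1 / 6 ≤ δ) :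
    IsApproxBasis 0 0 (3 * L * δ) (fun i _ => i.elim0) (leontiefFamily d L) := by
  have : Nonempty (Fin d) := ⟨⟨0, hd⟩⟩
  refine ⟨fun i => i.elim0, ?_⟩
  rintro f ⟨a, ha, hf⟩
  have ha0 : ∀ j, 0 < a j := fun j => lt_of_lt_of_le (by positivity) (ha j)
  refine ⟨-(L / 2), fun i => i.elim0, fun y => ?_, fun y y' => by simp⟩
  have h0 : 0 ≤ ⨅ j, (y j : ℝ) / a j := Real.iInf_nonneg fun j => div_nonneg (y j).2.1 (ha0 j).le
  have h1 : ⨅ j, (y j : ℝ) / a j ≤ L := by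
    refine (ciInf_le (Set.finite_range _).bddBelow ⟨0, hd⟩).trans ?_
    rw [div_le_iff₀ (ha0 _)]
    have := mul_le_mul_of_nonneg_left (ha ⟨0, hd⟩) hL.le
    rw [mul_one_div_cancel hL.ne'] at this
    exact (y _).2.2.trans this
  have h2 : L / 2 ≤ 3 * L * δ := by nlinarith
  rw [hf, Finset.univ_eq_empty, Finset.sum_empty, abs_le]
  constructor <;> linarith

theorem mainTheorem8 :
    ∃ c C : ℝ, 0 < c ∧ 0 < C ∧
      ∀ (d : ℕ) (L δ : ℝ), 1 ≤ d → 0 < L → 0 < δ → δ ≤ 1 →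
        ∃ (n : ℕ) (lam : ℝ) (s : Fin n → UnitCube d → ℝ),
          (n : ℝ) ≤ C * ((d : ℝ) ^ 4 * c ^ d * Real.log (1 / δ) ^ (3 * d + 1) /
            δ ^ ((6 * (d : ℝ) + 8) / ((d : ℝ) + 2))) ∧
          lam ≤ C * (L * (d : ℝ) ^ (5 / 2 : ℝ) * c ^ d *
            Real.log (1 / δ) ^ (2 * (d : ℝ) + 1 / 2) /
            δ ^ ((5 * (d : ℝ) + 6) / ((d : ℝ) + 2))) ∧
          IsApproxBasis n lam (3 * L * δ) s (leontiefFamily d L) := by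
  -- From `m ≤ 3 * ℓ`, `m ^ (2 * d + 1)` contributes `9 ^ d` and a factor 3; `147 = 3 * 49`, where
  -- 49 is 48 plus 1 for the ceiling.
  refine ⟨9, 147, by norm_num, by norm_num, fun d L δ hd hL hδ hδ1 => ?_⟩
  have hlog0 : 0 ≤ Real.log (1 / δ) := Real.log_nonneg ((one_le_div hδ).2 hδ1)
  rcases le_or_gt (1 / 6) δ with h6 | h6
  · refine ⟨0, 0, fun i _ => i.elim0, ?_, ?_, isApproxBasis_leontiefFamily_zero hd hL h6⟩
    · rw [Nat.cast_zero]
      positivity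
    · positivity
  have hd1 : (1 : ℝ) ≤ d := by exact_mod_cast hd
  set ℓ := Real.log (1 / δ) with hℓ
  have hℓ1 : 1 ≤ ℓ := by
    rw [hℓ, Real.le_log_iff_exp_le (by positivity), le_div_iff₀ hδ]
    nlinarith [Real.exp_one_lt_d9, Real.exp_pos 1]
  -- The factor 2 suffices for `1 / δ ≤ 2 ^ m` because `log 2 > 1 / 2`.
  set m : ℕ := ⌈2 * ℓ⌉₊ with hm
  have hm0 : 0 < m := Nat.ceil_pos.2 (by linarith)
  have hm1 : (1 : ℝ) ≤ m := by exact_mod_cast hm0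
  have hm3 : (m : ℝ) ≤ 3 * ℓ := by
    have := Nat.ceil_lt_add_one (by linarith : 0 ≤ 2 * ℓ)
    linarith
  have hmδ : 1 / δ ≤ 2 ^ m := by
    have h1 : 2 * ℓ ≤ m := Nat.le_ceil _
    rw [← Real.log_le_log_iff (by positivity) (by positivity), Real.log_pow]
    nlinarith [Real.log_two_gt_d9]
  set Q : ℝ := d * m * (m : ℝ) ^ (2 * d) / δ ^ 2 with hQ
  have hQ1 : 1 ≤ Q := by
    rw [hQ, le_div_iff₀ (by positivity), one_mul]
    calc δ ^ 2 ≤ 1 := pow_le_one₀ hδ.le hδ1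
      _ ≤ _ := one_le_mul_of_one_le_of_one_le (one_le_mul_of_one_le_of_one_le hd1 hm1)
        (one_le_pow₀ hm1)
  obtain ⟨s, hs⟩ := isApproxBasis_leontiefFamily_of_log hm0 hd hL hδ hδ1 hmδ ⌈48 * Q⌉₊
    ((le_of_eq (by rw [hQ]; ring)).trans (Nat.le_ceil _))
  refine ⟨⌈48 * Q⌉₊, _, s, ?_, ?_, hs⟩
  · have h1 := Nat.ceil_lt_add_one (by linarith : 0 ≤ 48 * Q)
    have hpow : δ ^ ((6 * (d : ℝ) + 8) / ((d : ℝ) + 2)) ≤ δ ^ 2 := by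
      rw [← Real.rpow_natCast δ 2]
      refine Real.rpow_le_rpow_of_exponent_ge hδ hδ1 ?_
      rw [le_div_iff₀ (by linarith)]
      push_cast
      linarith
    calc ((⌈48 * Q⌉₊ : ℕ) : ℝ) ≤ 49 * Q := by linarith
      _ ≤ 49 * (d * (3 * ℓ) * (3 * ℓ) ^ (2 * d) / δ ^ 2) := by rw [hQ]; gcongr
      _ = 147 * (d * 9 ^ d * ℓ ^ (2 * d + 1) / δ ^ 2) := by
          rw [mul_pow, pow_mul 3 2 d]
          ring
      _ ≤ _ := by
          gcongr
          · exact le_self_pow₀ hd1 (by norm_num)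
          · norm_num
  · have hpow : δ ^ ((5 * (d : ℝ) + 6) / ((d : ℝ) + 2)) ≤ 1 :=
      Real.rpow_le_one hδ.le hδ1 (by positivity)
    calc 2 * L * (m : ℝ) ^ d ≤ 2 * L * (3 * ℓ) ^ d := by gcongr
      _ = 2 * (L * 1 * 3 ^ d * ℓ ^ (d : ℝ) / 1) := by
          rw [mul_pow, Real.rpow_natCast]
          ring
      _ ≤ _ := by
          gcongr
          · norm_num
          · exact Real.one_le_rpow hd1 (by norm_num)
          · norm_num
          · linarith
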